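/- All graphs are simple and undirected. The distinguishing index $D'(\Gamma)$ of a graph $\Gamma$ is the least positive integer $d$ such that $\Gamma$ has an edge labeling with $d$ labels that is preserved only by the identity automorphism of $\Gamma$ (and $D'(\Gamma)=\infty$ if there is no such $d$). Let $\Gamma$ be a finite $k$-regular graph of order $n$. (i) If $\Gamma$ is connected, $n\neq 2$ (that is, $\Gamma\neq K_2$) and $k\le 4$, then $D'(\Gamma)\le 3$. (ii) If $k\ge \frac{n-1}{2}\ge 3$, then $D'(\Gamma)\le 2$; moreover $D'(\Gamma)=2$ whenever $\Gamma$ has a non-identity automorphism. (iii) Let $H$ be a finite group with $|H|\ge 3$ and identity $e$, let $S\subseteq H$ satisfy $e\notin S=S^{-1}$, and let $\mathrm{Cay}(H,S)$ be the graph with vertex set $H$ in which $h$ is adjacent to $sh$ for all $h\in H$, $s\in S$. If $\mathrm{Cay}(H,S)$ is a graphical regular representation of $H$, i.e. its automorphism group consists exactly of the right translations $x\mapsto xa$, $a\in H$, then $D'(\mathrm{Cay}(H,S))=2$, and the labeling that gives label $1$ to the edges incident with $e$ and label $2$ to all other edges is preserved only by the identity automorphism. -/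

import Mathlib

/-- An edge labeling `φ` of `G` is distinguishing if the only automorphism of `G` that
preserves the labels of all edges is the identity. -/
def IsDistinguishingEdgeLabeling {V L : Type*} (G : SimpleGraph V) (φ : G.edgeSet → L) : Prop :=
  ∀ σ : G ≃g G, (∀ e : G.edgeSet, φ (σ.mapEdgeSet e) = φ e) → σ = SimpleGraph.Iso.refl

/-- The distinguishing index `D'(G)`: the least positive integer `r` such that `G` has a
distinguishing edge labeling with `r` labels; it is `⊤` if there is no such `r`
(so that an upper bound on it asserts the existence of a labeling). -/
noncomputable def distinguishingIndex {V : Type*} (G : SimpleGraph V) : ℕ∞ :=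
  sInf {d : ℕ∞ | ∃ r : ℕ, d = (r : ℕ∞) ∧ 1 ≤ r ∧
    ∃ φ : G.edgeSet → Fin r, IsDistinguishingEdgeLabeling G φ}

/-- The (undirected) Cayley graph `Cay(H, S)`, where `1 ∉ S = S⁻¹`: the vertices are the elements
of `H`, and `h` is joined to `s * h` for all `h ∈ H` and `s ∈ S`. -/
def cayleyGraph {H : Type*} [Group H] (S : Set H) (h_one : (1 : H) ∉ S)
    (h_inv : ∀ s ∈ S, s⁻¹ ∈ S) : SimpleGraph H where
  Adj x y := ∃ s ∈ S, y = s * x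
  symm := ⟨fun x y hxy => by
    obtain ⟨s, hs, rfl⟩ := hxy
    exact ⟨s⁻¹, h_inv s hs, by simp⟩⟩
  loopless := ⟨fun x hx => by
    obtain ⟨s, hs, hsx⟩ := hx
    have h1 : s = 1 := by simpa using hsx.symm
    exact h_one (h1 ▸ hs)⟩

/-- A graph `Γ` whose vertex set is a group `H` satisfies `Aut(Γ) = R(H)`, where `R(H)` consists of
the right translations `x ↦ x * a`; for a Cayley graph of `H` this says that it is a graphical
regular representation of `H`. -/
def IsGraphicalRegularRepresentation {H : Type*} [Group H] (Γ : SimpleGraph H) : Prop :=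
  Set.range (fun σ : Γ ≃g Γ => σ.toEquiv) = Set.range (fun a : H => Equiv.mulRight a)

/-! For (i) with k = 3 or 4, label the edges of a longest path 0 and hang the other vertices from it
by a `RankedForest`. Forest edges at the path avoid label 0, and siblings get distinct labels. Two
longest paths meet (`IsLongestPathSeq.exists_common`), and label 0 never leads off the path, so a
label-preserving automorphism maps the path to itself, as the identity or the reversal. Labels on
the remaining edges separate the two ends and exclude the reversal. Once the path is fixed
pointwise, `RankedForest.eq_self` spreads this to all vertices. Degrees 0, 1, 2 are treated
directly.

For (ii), a Dirac-type argument gives a Hamiltonian path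
(`SimpleGraph.IsRegularOfDegree.exists_hamiltonian`). One label marks this path and a chord that
leaves tails of different positive lengths, a spanning asymmetric subgraph
(`ChordedPathRel.eq_self`). If the path has no such chord, adjacencies are so restricted that k = 4,
and rerouting the path produces one.

For (iii), a nontrivial right translation by a moves 1 to a, and it can keep the star of 1 within
itself only if S ⊆ {a⁻¹}. Then the graph has extra automorphisms
(`IsGraphicalRegularRepresentation.exists_mem_ne`). -/

/-- A labeling of all unordered pairs of vertices that is preserved on edges by no nontrivial
automorphism bounds the distinguishing index. -/
theorem distinguishingIndex_le_of_label {V : Type*} (G : SimpleGraph V) (r : ℕ) (hr : 1 ≤ r)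
    (c : Sym2 V → Fin r)
    (hc : ∀ σ : G ≃g G, (∀ x y, G.Adj x y → c s(σ x, σ y) = c s(x, y)) → ∀ v, σ v = v) :
    distinguishingIndex G ≤ r := by
  refine sInf_le ⟨r, rfl, hr, fun e => c e, fun σ hσ => ?_⟩
  ext v
  refine hc σ (fun x y hxy => ?_) v
  exact hσ ⟨s(x, y), hxy⟩

theorem two_le_distinguishingIndex {V : Type*} (G : SimpleGraph V)
    (h : ∃ σ : G ≃g G, σ ≠ SimpleGraph.Iso.refl) : 2 ≤ distinguishingIndex G := by
  obtain ⟨σ, hσ⟩ := h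
  refine le_sInf ?_
  rintro d ⟨r, rfl, hr, φ, hφ⟩
  by_contra hlt
  have h1 : r = 1 := by
    have : r < 2 := by exact_mod_cast not_le.1 hlt
    omega
  subst h1
  exact hσ (hφ σ fun e => Subsingleton.elim _ _)

/-! ### Longest paths -/

section PathSeq

variable {V : Type*} {G : SimpleGraph V}

/-- The first `m + 1` values of `p` are the successive vertices of a path in `G`. -/
structure IsPathSeq (G : SimpleGraph V) (m : ℕ) (p : ℕ → V) : Prop where
  adj : ∀ i, i < m → G.Adj (p i) (p (i + 1))
  inj : ∀ i j, i ≤ m → j ≤ m → p i = p j → i = j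

/-- A path that has the largest length among all paths of `G`. -/
structure IsLongestPathSeq (G : SimpleGraph V) (m : ℕ) (p : ℕ → V) : Prop
    extends IsPathSeq G m p where
  le : ∀ m' q, IsPathSeq G m' q → m' ≤ m

theorem IsPathSeq.lt_card [Fintype V] {m : ℕ} {p : ℕ → V} (h : IsPathSeq G m p) :
    m < Fintype.card V := by
  have := Fintype.card_le_of_injective (fun i : Fin (m + 1) => p i)
    (fun i j hij => Fin.ext (h.inj _ _ (by omega) (by omega) hij))
  simpa using this

theorem exists_isLongestPathSeq [Fintype V] [Nonempty V] (G : SimpleGraph V) :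
    ∃ m p, IsLongestPathSeq G m p := by
  classical
  have h0 : ∃ p, IsPathSeq G 0 p :=
    ⟨fun _ => Classical.arbitrary V, ⟨fun i hi => by omega, fun i j hi hj _ => by omega⟩⟩
  obtain ⟨p, hp⟩ := Nat.findGreatest_spec (P := fun m => ∃ p, IsPathSeq G m p)
    (Nat.zero_le (Fintype.card V)) h0
  exact ⟨_, p, hp, fun m' q hq => Nat.le_findGreatest hq.lt_card.le ⟨q, hq⟩⟩

theorem IsPathSeq.reverse {m : ℕ} {p : ℕ → V} (h : IsPathSeq G m p) :
    IsPathSeq G m (fun i => p (m - i)) where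
  adj i hi := by
    have := (h.adj (m - (i + 1)) (by omega)).symm
    rwa [show m - (i + 1) + 1 = m - i by omega] at this
  inj i j hi hj hij := by
    have := h.inj _ _ (by omega) (by omega) hij
    omega

theorem IsLongestPathSeq.reverse {m : ℕ} {p : ℕ → V} (h : IsLongestPathSeq G m p) :
    IsLongestPathSeq G m (fun i => p (m - i)) :=
  ⟨h.toIsPathSeq.reverse, h.le⟩

theorem IsPathSeq.take {m : ℕ} {p : ℕ → V} (h : IsPathSeq G m p) {a : ℕ} (ha : a ≤ m) :
    IsPathSeq G a p :=
  ⟨fun i hi => h.adj i (by omega), fun i j hi hj => h.inj i j (by omega) (by omega)⟩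

theorem IsPathSeq.glue {m m' : ℕ} {p q : ℕ → V} (hp : IsPathSeq G m p) (hq : IsPathSeq G m' q)
    (h0 : p m = q 0) (hd : ∀ i j, i < m → j ≤ m' → p i ≠ q j) :
    IsPathSeq G (m + m') (fun s => if s < m then p s else q (s - m)) where
  adj i hi := by
    rcases lt_trichotomy (i + 1) m with h | h | h
    · rw [if_pos (by omega), if_pos h]
      exact hp.adj i (by omega)
    · rw [if_pos (by omega), if_neg (by omega), show i + 1 - m = 0 by omega, ← h0, ← h]
      exact hp.adj i (by omega)
    · rw [if_neg (by omega), if_neg (by omega), show i + 1 - m = i - m + 1 by omega]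
      exact hq.adj _ (by omega)
  inj i j hi hj hij := by
    split_ifs at hij with h1 h2 h2
    · exact hp.inj _ _ (by omega) (by omega) hij
    · exact absurd hij (hd _ _ h1 (by omega))
    · exact absurd hij.symm (hd _ _ h2 (by omega))
    · have := hq.inj _ _ (by omega) (by omega) hij
      omega

theorem IsPathSeq.cons {m : ℕ} {p : ℕ → V} (hp : IsPathSeq G m p) {w : V} (hw : G.Adj w (p 0))
    (hd : ∀ i ≤ m, p i ≠ w) : IsPathSeq G (m + 1) (fun s => if s = 0 then w else p (s - 1)) where
  adj i hi := by
    rcases Nat.eq_zero_or_pos i with rfl | h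
    · simpa using hw
    · have := hp.adj (i - 1) (by omega)
      rw [if_neg (by omega), if_neg (by omega)]
      rwa [show i - 1 + 1 = i + 1 - 1 by omega] at this
  inj i j hi hj hij := by
    split_ifs at hij with h1 h2 h2
    · omega
    · exact absurd hij.symm (hd _ (by omega))
    · exact absurd hij (hd _ (by omega))
    · have := hp.inj _ _ (by omega) (by omega) hij
      omega

theorem IsLongestPathSeq.mem_of_adj_zero {m : ℕ} {p : ℕ → V} (h : IsLongestPathSeq G m p) {w : V}
    (hw : G.Adj (p 0) w) : ∃ i ≤ m, p i = w := by
  by_contra! hd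
  have := h.le _ _ (h.toIsPathSeq.cons hw.symm hd)
  omega

theorem IsLongestPathSeq.mem_of_adj_last {m : ℕ} {p : ℕ → V} (h : IsLongestPathSeq G m p) {w : V}
    (hw : G.Adj (p m) w) : ∃ i ≤ m, p i = w := by
  obtain ⟨i, hi, rfl⟩ := h.reverse.mem_of_adj_zero (w := w) (by simpa using hw)
  exact ⟨m - i, by omega, rfl⟩

/-- The path `p (t - 1), …, p 0, p t, …, p m`. -/
theorem IsPathSeq.rotate {m : ℕ} {p : ℕ → V} (h : IsPathSeq G m p) {t : ℕ} (ht : t ≤ m)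
    (hadj : G.Adj (p 0) (p t)) :
    IsPathSeq G m (fun s => if s < t then p (t - 1 - s) else p s) where
  adj i hi := by
    rcases lt_trichotomy (i + 1) t with h1 | h1 | h1
    · rw [if_pos (by omega), if_pos h1]
      have := (h.adj (t - 1 - (i + 1)) (by omega)).symm
      rwa [show t - 1 - (i + 1) + 1 = t - 1 - i by omega] at this
    · rw [if_pos (by omega), if_neg (by omega), show t - 1 - i = 0 by omega, h1]
      exact hadj
    · rw [if_neg (by omega), if_neg (by omega)]
      exact h.adj i hi
  inj i j hi hj hij := by
    split_ifs at hij with h1 h2 h2 <;> have := h.inj _ _ (by omega) (by omega) hij <;> omega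

/-- In a connected graph, a proper nonempty set of vertices has an edge leaving it. -/
theorem SimpleGraph.Connected.exists_adj_boundary (hG : G.Connected) {S : Set V} {u v : V}
    (hu : u ∈ S) (hv : v ∉ S) : ∃ x y, G.Adj x y ∧ x ∈ S ∧ y ∉ S := by
  obtain ⟨w⟩ := hG.preconnected u v
  obtain ⟨d, -, h1, h2⟩ := w.exists_boundary_dart S hu hv
  exact ⟨d.fst, d.snd, d.adj, h1, h2⟩

/-- A longest path of a connected graph whose ends are adjacent is Hamiltonian. -/
theorem IsLongestPathSeq.mem_of_closed {m : ℕ} {p : ℕ → V} (h : IsLongestPathSeq G m p)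
    (hG : G.Connected) (hc : G.Adj (p 0) (p m)) (v : V) : ∃ i ≤ m, p i = v := by
  by_contra hv
  obtain ⟨x, w, hxw, ⟨t, ht, rfl⟩, hw⟩ := hG.exists_adj_boundary
    (S := {x | ∃ i ≤ m, p i = x}) (u := p 0) ⟨0, by omega, rfl⟩ hv
  -- Cut the closed path just before `p t`, so that it starts at `p t` and can be extended by `w`.
  have hrot : IsPathSeq G m (fun s => if s + t ≤ m then p (s + t) else p (s + t - m - 1)) := by
    constructor
    · intro i hi
      rcases lt_trichotomy (i + t) m with h1 | h1 | h1
      · rw [if_pos (by omega), if_pos (by omega), show i + 1 + t = i + t + 1 by omega]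
        exact h.adj _ h1
      · rw [if_pos (by omega), if_neg (by omega), show i + 1 + t - m - 1 = 0 by omega, h1]
        exact hc.symm
      · rw [if_neg (by omega), if_neg (by omega),
          show i + 1 + t - m - 1 = i + t - m - 1 + 1 by omega]
        exact h.adj _ (by omega)
    · intro i j hi hj hij
      split_ifs at hij with h1 h2 h2 <;> have := h.inj _ _ (by omega) (by omega) hij <;> omega
  have := h.le _ _ (hrot.cons (w := w) (by simpa [ht] using hxw.symm) (by
    intro i hi hiw
    apply hw
    split_ifs at hiw with h1
    · exact ⟨_, h1, hiw⟩
    · exact ⟨_, by omega, hiw⟩))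
  omega

/-- From any vertex `p a` of a path of length `m` there is a subpath of length at least `m / 2`
that ends in `p a`. -/
theorem IsPathSeq.exists_half {m : ℕ} {p : ℕ → V} (h : IsPathSeq G m p) {a : ℕ} (ha : a ≤ m) :
    ∃ A q, m ≤ 2 * A ∧ IsPathSeq G A q ∧ q A = p a ∧ ∀ i ≤ A, ∃ j ≤ m, p j = q i := by
  rcases le_total m (2 * a) with h1 | h1
  · exact ⟨a, p, h1, h.take ha, rfl, fun i hi => ⟨i, by omega, rfl⟩⟩
  · refine ⟨m - a, fun i => p (m - i), by omega, h.reverse.take (by omega), ?_, fun i hi =>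
      ⟨m - i, by omega, rfl⟩⟩
    simp only
    congr 1
    omega

/-- Any two longest paths of a connected graph meet. -/
theorem IsLongestPathSeq.exists_common {m : ℕ} {p q : ℕ → V} (h : IsLongestPathSeq G m p)
    (hG : G.Connected) (hq : IsPathSeq G m q) : ∃ i j, i ≤ m ∧ j ≤ m ∧ p i = q j := by
  classical
  by_contra! hd
  -- Take a shortest walk between the two disjoint paths: minimality makes it a path that meets each
  -- of them only at one end.
  have hex : ∃ l, ∃ w : ℕ → V, (∀ i < l, G.Adj (w i) (w (i + 1))) ∧ (∃ a ≤ m, p a = w 0) ∧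
      ∃ b ≤ m, q b = w l := by
    obtain ⟨w⟩ := hG.preconnected (p 0) (q 0)
    exact ⟨w.length, w.getVert, fun i hi => w.adj_getVert_succ hi, ⟨0, by omega, by simp⟩,
      ⟨0, by omega, by simp⟩⟩
  obtain ⟨w, hw, ⟨a, ha, hpa⟩, ⟨b, hb, hqb⟩⟩ := Nat.find_spec hex
  set l := Nat.find hex with hl
  have hmin : ∀ l' < l, ¬ ∃ w : ℕ → V, (∀ i < l', G.Adj (w i) (w (i + 1))) ∧
      (∃ a ≤ m, p a = w 0) ∧ ∃ b ≤ m, q b = w l' := fun l' h' => Nat.find_min hex h'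
  have hpw : ∀ i j, i ≤ m → 0 < j → j ≤ l → p i ≠ w j := by
    intro i j hi hj hjl hij
    refine hmin (l - j) (by omega) ⟨fun s => w (s + j), fun s hs => ?_, ⟨i, hi, by simpa using hij⟩,
      ⟨b, hb, by simpa [hjl] using hqb⟩⟩
    have := hw (s + j) (by omega)
    rwa [show s + j + 1 = s + 1 + j by omega] at this
  have hqw : ∀ i j, i ≤ m → j < l → q i ≠ w j := by
    intro i j hi hj hij
    exact hmin j hj ⟨w, fun s hs => hw s (by omega), ⟨a, ha, hpa⟩, ⟨i, hi, hij⟩⟩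
  have hlt : ∀ i j, i < j → j ≤ l → w i ≠ w j := by
    intro i j hij hj he
    refine hmin (l - (j - i)) (by omega) ⟨fun s => if s ≤ i then w s else w (s + (j - i)),
      fun s hs => ?_, ⟨a, ha, by simpa using hpa⟩, ⟨b, hb, ?_⟩⟩
    · dsimp only
      rcases lt_trichotomy s i with h1 | h1 | h1
      · rw [if_pos (by omega), if_pos (by omega)]
        exact hw s (by omega)
      · rw [if_pos (by omega), if_neg (by omega), h1, he,
          show i + 1 + (j - i) = j + 1 by omega]
        exact hw j (by omega)
      · rw [if_neg (by omega), if_neg (by omega), show s + 1 + (j - i) = s + (j - i) + 1 by omega]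
        exact hw _ (by omega)
    · dsimp only
      split_ifs with h1
      · rw [hqb, show l - (j - i) = i by omega, he]
        congr 1
        omega
      · rw [hqb]
        congr 1
        omega
  have hwp : IsPathSeq G l w := by
    refine ⟨hw, fun i j hi hj hij => ?_⟩
    rcases lt_trichotomy i j with h1 | h1 | h1
    · exact absurd hij (hlt i j h1 hj)
    · exact h1
    · exact absurd hij.symm (hlt j i h1 hi)
  have hl0 : 0 < l := by
    by_contra h0
    exact hd a b ha hb (by rw [hpa, hqb]; congr 1; omega)
  -- Half of `p`, the connection, and half of `q` form a path of length `A + l + B ≥ m + l > m`.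
  obtain ⟨A, p', hA, hp', hpA, hps⟩ := h.toIsPathSeq.exists_half ha
  obtain ⟨B, q', hB, hq', hqB, hqs⟩ := hq.exists_half hb
  have h1 := hp'.glue hwp (by rw [hpA, hpa]) (by
    intro i j hi hj hij
    rcases Nat.eq_zero_or_pos j with rfl | h0
    · rw [← hpa, ← hpA] at hij
      have := hp'.inj _ _ (by omega) (by omega) hij
      omega
    · obtain ⟨i', hi', he⟩ := hps i (by omega)
      exact hpw i' j hi' h0 hj (he.trans hij))
  have h2 := h1.glue hq'.reverse (by
    rw [if_neg (by omega), show A + l - A = l by omega, ← hqb, ← hqB]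
    simp) (by
    intro i j hi hj hij
    obtain ⟨j', hj', he⟩ := hqs (B - j) (by omega)
    split_ifs at hij with h3
    · obtain ⟨i', hi', he'⟩ := hps i (by omega)
      exact hd i' j' hi' hj' (by rw [he', hij, he])
    · exact hqw j' (i - A) hj' (by omega) (by rw [he, hij]))
  have := h.le _ _ h2
  omega

end PathSeq

/-! ### Asymmetry of a path with a chord -/

/-- Adjacency of the graph on `ℕ` formed by the infinite path `0, 1, 2, …` and the chord `i j`. -/
def ChordedPathRel (i j a b : ℕ) : Prop :=
  a + 1 = b ∨ b + 1 = a ∨ (a = i ∧ b = j) ∨ (a = j ∧ b = i)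

/-- A path with a chord that leaves tails of different positive lengths is asymmetric. -/
theorem ChordedPathRel.eq_self {i j m : ℕ} (hi : 0 < i) (hij : i + 2 ≤ j)
    (hm : i + j < m) {f : ℕ → ℕ} (hf : ∀ a ≤ m, f a ≤ m)
    (hinj : ∀ a b, a ≤ m → b ≤ m → f a = f b → a = b) (hsurj : ∀ b ≤ m, ∃ a ≤ m, f a = b)
    (hR : ∀ a b, a ≤ m → b ≤ m → (ChordedPathRel i j a b ↔ ChordedPathRel i j (f a) (f b)))
    {a : ℕ} (ha : a ≤ m) : f a = a := by
  have hne : ∀ a b, a ≤ m → b ≤ m → a ≠ b → f a ≠ f b := fun a b ha hb h h' => h (hinj a b ha hb h')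
  unfold ChordedPathRel at hR
  -- Only `i` and `j` have three neighbors.
  have hfi : f i = i ∨ f i = j := by
    have h1 := (hR i (i - 1) (by omega) (by omega)).1 (by omega)
    have h2 := (hR i (i + 1) (by omega) (by omega)).1 (by omega)
    have h3 := (hR i j (by omega) (by omega)).1 (by omega)
    have h4 := hne (i - 1) (i + 1) (by omega) (by omega) (by omega)
    have h5 := hne (i - 1) j (by omega) (by omega) (by omega)
    have h6 := hne (i + 1) j (by omega) (by omega) (by omega)
    omega
  have hfj : f j = i ∨ f j = j := by
    have h1 := (hR j (j - 1) (by omega) (by omega)).1 (by omega)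
    have h2 := (hR j (j + 1) (by omega) (by omega)).1 (by omega)
    have h3 := (hR j i (by omega) (by omega)).1 (by omega)
    have h4 := hne (j - 1) (j + 1) (by omega) (by omega) (by omega)
    have h5 := hne (j - 1) i (by omega) (by omega) (by omega)
    have h6 := hne (j + 1) i (by omega) (by omega) (by omega)
    omega
  have hfij := hne i j (by omega) (by omega) (by omega)
  -- Otherwise `f 0` has two neighbors, whereas 0 has only one.
  have hf0 : f 0 = 0 ∨ f 0 = m := by
    by_contra! h
    have h0 := hf 0 (by omega)
    obtain ⟨x, hx, hfx⟩ := hsurj (f 0 - 1) (by omega)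
    obtain ⟨y, hy, hfy⟩ := hsurj (f 0 + 1) (by omega)
    have h1 := (hR 0 x (by omega) hx).2 (by omega)
    have h2 := (hR 0 y (by omega) hy).2 (by omega)
    have h3 : x = y := by omega
    subst h3
    omega
  rcases hf0 with h0 | h0
  · induction a using Nat.strong_induction_on with
    | _ a ih =>
      rcases Nat.eq_zero_or_pos a with rfl | h
      · exact h0
      obtain ⟨t, rfl⟩ : ∃ t, a = t + 1 := ⟨a - 1, by omega⟩
      have h1 := ih t (by omega) (by omega)
      have h2 := (hR t (t + 1) (by omega) ha).1 (by omega)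
      have h3 : i ≤ t → f i = i := fun h => ih i (by omega) (by omega)
      have h5 := hne (t + 1) i ha (by omega)
      have h6 := hne (t + 1) j ha (by omega)
      by_cases ht : t = 0
      · subst ht
        omega
      · have h7 := ih (t - 1) (by omega) (by omega)
        have h8 := hne (t + 1) (t - 1) ha (by omega) (by omega)
        omega
  · exfalso
    -- If the ends were exchanged, walking inwards would send `i` to `m - i > j`, which is neither
    -- `i` nor `j`.
    have key : ∀ t ≤ i, f t = m - t := by
      intro t
      induction t using Nat.strong_induction_on with
      | _ t ih =>
        intro ht
        rcases Nat.eq_zero_or_pos t with rfl | h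
        · simpa using h0
        obtain ⟨t, rfl⟩ : ∃ s, t = s + 1 := ⟨t - 1, by omega⟩
        have h1 := ih t (by omega) (by omega)
        have h2 := (hR t (t + 1) (by omega) (by omega)).1 (by omega)
        have h9 := hf (t + 1) (by omega)
        by_cases ht : t = 0
        · subst ht
          omega
        · have h7 := ih (t - 1) (by omega) (by omega)
          have h8 := hne (t + 1) (t - 1) (by omega) (by omega) (by omega)
          omega
    have := key i le_rfl
    omega

/-! ### Hamiltonian paths and regular graphs of large degree -/

section Traceable

variable {V : Type*} {G : SimpleGraph V}

/-- Label 0 marks exactly the path and the chord, so a label-preserving automorphism, read on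
indices, is an automorphism of the asymmetric chorded path. -/
theorem IsPathSeq.distinguishingIndex_le_two_aux {m : ℕ} {p : ℕ → V} (hp : IsPathSeq G m p)
    (hs : ∀ v, ∃ a ≤ m, p a = v) {i j : ℕ} (hi : 0 < i) (hij : i + 2 ≤ j) (hm : i + j < m)
    (hadj : G.Adj (p i) (p j)) : distinguishingIndex G ≤ 2 := by
  classical
  have hc : ∀ a b, a ≤ m → b ≤ m → ((∃ s < m, s(p a, p b) = s(p s, p (s + 1))) ∨
      s(p a, p b) = s(p i, p j) ↔ ChordedPathRel i j a b) := by
    intro a b ha hb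
    have hiff : ∀ x y, x ≤ m → y ≤ m → (p x = p y ↔ x = y) :=
      fun x y hx hy => ⟨hp.inj x y hx hy, fun h => h ▸ rfl⟩
    unfold ChordedPathRel
    simp only [Sym2.eq_iff]
    rw [hiff a i ha (by omega), hiff a j ha (by omega), hiff b i hb (by omega),
      hiff b j hb (by omega)]
    constructor
    · rintro (⟨s, hs, h⟩ | h)
      · rw [hiff a s ha (by omega), hiff a (s + 1) ha (by omega), hiff b s hb (by omega),
          hiff b (s + 1) hb (by omega)] at h
        omega
      · omega
    · rintro (rfl | rfl | h)
      · exact Or.inl ⟨a, by omega, Or.inl ⟨rfl, rfl⟩⟩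
      · exact Or.inl ⟨b, by omega, Or.inr ⟨rfl, rfl⟩⟩
      · exact Or.inr h
  have hcadj : ∀ a b, a ≤ m → b ≤ m → ChordedPathRel i j a b → G.Adj (p a) (p b) := by
    rintro a b ha hb (rfl | rfl | ⟨rfl, rfl⟩ | ⟨rfl, rfl⟩)
    · exact hp.adj _ (by omega)
    · exact (hp.adj _ (by omega)).symm
    · exact hadj
    · exact hadj.symm
  refine distinguishingIndex_le_of_label G 2 (by norm_num)
    (fun e => if (∃ s < m, e = s(p s, p (s + 1))) ∨ e = s(p i, p j) then 0 else 1)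
    fun σ hσ v => ?_
  choose f hfm hf using fun a => hs (σ (p a))
  have hR : ∀ a b, a ≤ m → b ≤ m → G.Adj (p a) (p b) →
      (ChordedPathRel i j a b ↔ ChordedPathRel i j (f a) (f b)) := by
    intro a b ha hb hab
    have h := hσ _ _ hab
    rw [← hf, ← hf] at h
    simp only [hc a b ha hb, hc _ _ (hfm a) (hfm b)] at h
    split_ifs at h with h1 h2 h2 <;> simp_all
  obtain ⟨a, ha, rfl⟩ := hs v
  have hfa : f a = a := by
    refine ChordedPathRel.eq_self hi hij hm (fun a _ => hfm a) ?_ ?_ ?_ ha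
    · intro a b ha hb hab
      have h : σ (p a) = σ (p b) := by rw [← hf, ← hf, hab]
      exact hp.inj a b ha hb (σ.injective h)
    · intro b hb
      obtain ⟨a, ha, hpa⟩ := hs (σ.symm (p b))
      refine ⟨a, ha, hp.inj _ _ (hfm a) hb ?_⟩
      rw [hf, hpa]
      simp
    · intro a b ha hb
      refine ⟨fun h => (hR a b ha hb (hcadj a b ha hb h)).1 h, fun h => (hR a b ha hb ?_).2 h⟩
      have := hcadj _ _ (hfm a) (hfm b) h
      rw [hf, hf] at this
      exact σ.map_rel_iff.1 this
  rw [← hf, hfa]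

/-- A graph with a Hamiltonian path and a chord of it that leaves tails of different positive
lengths has distinguishing index at most two. -/
theorem IsPathSeq.distinguishingIndex_le_two {m : ℕ} {p : ℕ → V} (hp : IsPathSeq G m p)
    (hs : ∀ v, ∃ a ≤ m, p a = v) {i j : ℕ} (hi : 0 < i) (hij : i + 2 ≤ j) (hj : j < m)
    (hm : i + j ≠ m) (hadj : G.Adj (p i) (p j)) : distinguishingIndex G ≤ 2 := by
  rcases lt_or_gt_of_ne hm with h | h
  · exact hp.distinguishingIndex_le_two_aux hs hi hij h hadj
  -- Reversal turns the index sum `i + j` into `2m - (i + j)`, which is less than `m`.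
  · refine hp.reverse.distinguishingIndex_le_two_aux (i := m - j) (j := m - i) (fun v => ?_)
      (by omega) (by omega) (by omega) ?_
    · obtain ⟨a, ha, rfl⟩ := hs v
      exact ⟨m - a, by omega, by congr 1; omega⟩
    · rw [show m - (m - j) = j by omega, show m - (m - i) = i by omega]
      exact hadj.symm

variable [Fintype V] [DecidableRel G.Adj]

/-- Two nonadjacent vertices have their k neighbors each among the other n - 2 < 2k vertices, hence
a common one. -/
theorem SimpleGraph.IsRegularOfDegree.connected_of_card_le {k : ℕ} [Nonempty V]
    (hk : G.IsRegularOfDegree k) (h : Fintype.card V ≤ 2 * k + 1) : G.Connected := by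
  classical
  refine ⟨fun x y => ?_⟩
  by_cases hxy : x = y
  · exact hxy ▸ SimpleGraph.Reachable.refl x
  by_cases hadj : G.Adj x y
  · exact hadj.reachable
  have hnd : ¬ Disjoint (G.neighborFinset x) (G.neighborFinset y) := by
    intro hd
    have h1 : G.neighborFinset x ∪ G.neighborFinset y ⊆ Finset.univ \ {x, y} := by
      intro z hz
      simp only [Finset.mem_union, SimpleGraph.mem_neighborFinset] at hz
      simp only [Finset.mem_sdiff, Finset.mem_univ, true_and, Finset.mem_insert,
        Finset.mem_singleton]
      rintro (rfl | rfl)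
      · rcases hz with hz | hz
        · exact G.irrefl hz
        · exact hadj hz.symm
      · rcases hz with hz | hz
        · exact hadj hz
        · exact G.irrefl hz
    have h2 := Finset.card_le_card h1
    rw [Finset.card_union_of_disjoint hd, Finset.card_sdiff_of_subset (Finset.subset_univ _),
      Finset.card_pair hxy, SimpleGraph.card_neighborFinset_eq_degree,
      SimpleGraph.card_neighborFinset_eq_degree, hk x, hk y, Finset.card_univ] at h2
    have h3 : 2 ≤ Fintype.card V := by
      rw [← Finset.card_pair hxy]
      exact Finset.card_le_univ _
    omega
  obtain ⟨z, hz1, hz2⟩ := Finset.not_disjoint_iff.1 hnd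
  rw [SimpleGraph.mem_neighborFinset] at hz1 hz2
  exact hz1.reachable.trans hz2.symm.reachable

/-- A Dirac-type condition for a Hamiltonian path. -/
theorem SimpleGraph.IsRegularOfDegree.exists_hamiltonian {k : ℕ} [Nonempty V]
    (hk : G.IsRegularOfDegree k) (h : Fintype.card V ≤ 2 * k + 1) :
    ∃ p, IsPathSeq G (Fintype.card V - 1) p ∧ ∀ v, ∃ a ≤ Fintype.card V - 1, p a = v := by
  classical
  have hG := hk.connected_of_card_le h
  obtain ⟨m, p, hp⟩ := exists_isLongestPathSeq G
  have hlt := hp.lt_card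
  suffices hs : ∀ v, ∃ a ≤ m, p a = v by
    have h1 : (Finset.univ : Finset V) ⊆ (Finset.range (m + 1)).image p := by
      intro v _
      obtain ⟨a, ha, rfl⟩ := hs v
      exact Finset.mem_image_of_mem _ (Finset.mem_range.2 (by omega))
    have h2 := (Finset.card_le_card h1).trans Finset.card_image_le
    rw [Finset.card_univ, Finset.card_range] at h2
    obtain rfl : m = Fintype.card V - 1 := by omega
    exact ⟨p, hp.toIsPathSeq, hs⟩
  by_contra! hv
  obtain ⟨v, hv⟩ := hv
  have hm : m + 1 < Fintype.card V := by
    have h1 : (Finset.range (m + 1)).image p ⊆ Finset.univ.erase v := by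
      intro x hx
      obtain ⟨a, ha, rfl⟩ := Finset.mem_image.1 hx
      exact Finset.mem_erase.2 ⟨hv a (by simpa [Nat.lt_succ_iff] using ha), Finset.mem_univ _⟩
    have h2 := Finset.card_le_card h1
    rw [Finset.card_image_of_injOn, Finset.card_range, Finset.card_erase_of_mem (Finset.mem_univ _),
      Finset.card_univ] at h2
    · omega
    · intro a ha b hb hab
      simp only [Finset.coe_range, Set.mem_Iio] at ha hb
      exact hp.inj a b (by omega) (by omega) hab
  -- Both sets have at least k elements among `m ≤ n - 2 < 2k` indices. A common index `t` gives the
  -- path `p t, …, p 0, p (t + 1), …, p m` with adjacent ends, which must be Hamiltonian.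
  let A := (Finset.range m).filter fun t => G.Adj (p 0) (p (t + 1))
  let B := (Finset.range m).filter fun t => G.Adj (p m) (p t)
  have hA : k ≤ A.card := by
    have h1 : G.neighborFinset (p 0) ⊆ A.image fun t => p (t + 1) := by
      intro w hw
      rw [SimpleGraph.mem_neighborFinset] at hw
      obtain ⟨t, ht, rfl⟩ := hp.mem_of_adj_zero hw
      have h0 : t ≠ 0 := by
        rintro rfl
        exact G.irrefl hw
      refine Finset.mem_image.2 ⟨t - 1, Finset.mem_filter.2 ⟨Finset.mem_range.2 (by omega), ?_⟩, ?_⟩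
      · rwa [show t - 1 + 1 = t by omega]
      · rw [show t - 1 + 1 = t by omega]
    have h2 := (Finset.card_le_card h1).trans Finset.card_image_le
    rwa [SimpleGraph.card_neighborFinset_eq_degree, hk] at h2
  have hB : k ≤ B.card := by
    have h1 : G.neighborFinset (p m) ⊆ B.image p := by
      intro w hw
      rw [SimpleGraph.mem_neighborFinset] at hw
      obtain ⟨t, ht, rfl⟩ := hp.mem_of_adj_last hw
      have h0 : t ≠ m := by
        rintro rfl
        exact G.irrefl hw
      exact Finset.mem_image.2 ⟨t, Finset.mem_filter.2 ⟨Finset.mem_range.2 (by omega), hw⟩, rfl⟩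
    have h2 := (Finset.card_le_card h1).trans Finset.card_image_le
    rwa [SimpleGraph.card_neighborFinset_eq_degree, hk] at h2
  have hnd : ¬ Disjoint A B := by
    intro hd
    have h1 : A ∪ B ⊆ Finset.range m :=
      Finset.union_subset (Finset.filter_subset _ _) (Finset.filter_subset _ _)
    have h2 := Finset.card_le_card h1
    rw [Finset.card_union_of_disjoint hd, Finset.card_range] at h2
    omega
  obtain ⟨t, htA, htB⟩ := Finset.not_disjoint_iff.1 hnd
  obtain ⟨ht, hA'⟩ := Finset.mem_filter.1 htA
  obtain ⟨-, hB'⟩ := Finset.mem_filter.1 htB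
  rw [Finset.mem_range] at ht
  have hrot : IsLongestPathSeq G m (fun s => if s ≤ t then p (t - s) else p s) := by
    refine ⟨?_, hp.le⟩
    convert hp.toIsPathSeq.rotate (t := t + 1) (by omega) hA' using 2 with s
    simp only [Nat.lt_succ_iff, Nat.add_sub_cancel]
  obtain ⟨a, ha, hav⟩ := hrot.mem_of_closed hG (by
    rw [if_pos (by omega), if_neg (by omega)]
    exact hB'.symm) v
  split_ifs at hav with h1
  · exact hv _ (by omega) hav
  · exact hv _ ha hav

/-- A regular graph of degree at least `(n - 1) / 2`, where `n ≥ 7` is its order, has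
distinguishing index at most two. -/
theorem SimpleGraph.IsRegularOfDegree.distinguishingIndex_le_two {k : ℕ}
    (hk : G.IsRegularOfDegree k) (h : Fintype.card V ≤ 2 * k + 1) (h7 : 7 ≤ Fintype.card V) :
    distinguishingIndex G ≤ 2 := by
  classical
  have : Nonempty V := Fintype.card_pos_iff.1 (by omega)
  obtain ⟨p, hp, hs⟩ := hk.exists_hamiltonian h
  set n := Fintype.card V with hn
  -- Degree 3 would force n = 7 and the odd degree sum 21.
  have hk4 : 4 ≤ k := by
    by_contra hlt
    have h1 := G.sum_degrees_eq_twice_card_edges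
    simp only [hk _, Finset.sum_const, Finset.card_univ, smul_eq_mul, ← hn] at h1
    obtain ⟨rfl, hn7⟩ : k = 3 ∧ n = 7 := by omega
    rw [hn7] at h1
    omega
  by_contra hbad
  have hch : ∀ i j, 0 < i → i + 2 ≤ j → j < n - 1 → i + j ≠ n - 1 → ¬ G.Adj (p i) (p j) :=
    fun i j h1 h2 h3 h4 h5 => hbad (hp.distinguishingIndex_le_two hs h1 h2 h3 h4 h5)
  -- Without a usable chord, an inner vertex sees only the ends, its path neighbors and its mirror
  -- image.
  have hnb : ∀ i, 0 < i → i < n - 1 → ∀ j ≤ n - 1, G.Adj (p i) (p j) →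
      j = 0 ∨ j = n - 1 ∨ j + 1 = i ∨ j = i + 1 ∨ i + j = n - 1 := by
    intro i hi hin j hj hadj
    by_contra hne
    have h0 : i ≠ j := by
      rintro rfl
      exact G.irrefl hadj
    rcases lt_or_gt_of_ne h0 with h1 | h1
    · exact hch i j hi (by omega) (by omega) (by omega) hadj
    · exact hch j i (by omega) (by omega) (by omega) (by omega) hadj.symm
  have hcard : ∀ i, ∀ T : Finset ℕ, (∀ j ≤ n - 1, G.Adj (p i) (p j) → j ∈ T) → k ≤ T.card := by
    intro i T hT
    have h1 : G.neighborFinset (p i) ⊆ T.image p := by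
      intro w hw
      rw [SimpleGraph.mem_neighborFinset] at hw
      obtain ⟨j, hj, rfl⟩ := hs w
      exact Finset.mem_image_of_mem _ (hT j hj hw)
    have h2 := (Finset.card_le_card h1).trans Finset.card_image_le
    rwa [SimpleGraph.card_neighborFinset_eq_degree, hk] at h2
  have hle4 : k ≤ 4 := by
    refine (hcard 1 {0, n - 1, 2, n - 2} fun j hj hadj => ?_).trans Finset.card_le_four
    have h1 := hnb 1 (by omega) (by omega) j hj hadj
    have h2 : j ≠ 1 := by
      rintro rfl
      exact G.irrefl hadj
    simp only [Finset.mem_insert, Finset.mem_singleton]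
    omega
  have hlast : G.Adj (p 0) (p (n - 2)) := by
    by_contra hna
    have := (hcard (n - 2) {n - 1, n - 3, 1} fun j hj hadj => ?_).trans Finset.card_le_three
    · omega
    have h1 := hnb (n - 2) (by omega) (by omega) j hj hadj
    have h2 : j ≠ 0 := by
      rintro rfl
      exact hna hadj.symm
    simp only [Finset.mem_insert, Finset.mem_singleton]
    omega
  -- The mirror image of `n / 2` is itself or its predecessor, so it contributes no further
  -- neighbor.
  have hmid : G.Adj (p 0) (p (n / 2)) := by
    by_contra hna
    have := (hcard (n / 2) {n - 1, n / 2 - 1, n / 2 + 1} fun j hj hadj => ?_).trans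
      Finset.card_le_three
    · omega
    have h1 := hnb (n / 2) (by omega) (by omega) j hj hadj
    have h2 : j ≠ 0 := by
      rintro rfl
      exact hna hadj.symm
    have h3 : j ≠ n / 2 := by
      rintro rfl
      exact G.irrefl hadj
    simp only [Finset.mem_insert, Finset.mem_singleton]
    omega
  -- After the rotation `p 0` has index `n / 2 - 1`, so its edge to `p (n - 2)` is an inner chord.
  -- The index sum is not `n - 1` because `n / 2 ≠ 2`.
  refine hbad ((hp.rotate (t := n / 2) (by omega) hmid).distinguishingIndex_le_two
    (i := n / 2 - 1) (j := n - 2) (fun v => ?_) (by omega) (by omega) (by omega) (by omega) ?_)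
  · obtain ⟨a, ha, rfl⟩ := hs v
    by_cases h1 : a < n / 2
    · exact ⟨n / 2 - 1 - a, by omega, by rw [if_pos (by omega)]; congr 1; omega⟩
    · exact ⟨a, ha, if_neg h1⟩
  · rw [if_pos (by omega), if_neg (by omega), Nat.sub_self]
    exact hlast

end Traceable

/-! ### Connected regular graphs of degree at most four -/

section SmallDegree

variable {V : Type*} {G : SimpleGraph V}

/-- In a connected graph a set of vertices closed under adjacency contains all vertices. -/
theorem SimpleGraph.Connected.forall_of_closed (hG : G.Connected) {P : V → Prop} {u : V} (hu : P u)
    (h : ∀ x y, G.Adj x y → P x → P y) (v : V) : P v := by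
  by_contra hv
  obtain ⟨x, y, hxy, hx, hy⟩ := hG.exists_adj_boundary (S := {x | P x}) hu hv
  exact hy (h x y hxy hx)

/-- Private labels on the two edges at `b` fix `b` and its neighbors. In degree two, a fixed vertex
with one fixed neighbor has both neighbors fixed, and connectedness does the rest. -/
theorem SimpleGraph.Connected.distinguishingIndex_le_three_of_two (hG : G.Connected)
    [DecidableEq V] [G.LocallyFinite] (h2 : G.IsRegularOfDegree 2) :
    distinguishingIndex G ≤ 3 := by
  obtain ⟨b⟩ := hG.nonempty
  have hN : ∀ x u, G.Adj x u → ∃ w, w ≠ u ∧ G.Adj x w ∧ ∀ y, G.Adj x y → y = u ∨ y = w := by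
    intro x u hu
    obtain ⟨y, z, hyz, he⟩ := Finset.card_eq_two.1
      ((SimpleGraph.card_neighborFinset_eq_degree G x).trans (h2 x))
    have hm : ∀ w, G.Adj x w ↔ w = y ∨ w = z := fun w => by
      rw [← SimpleGraph.mem_neighborFinset, he]
      simp
    rcases (hm u).1 hu with rfl | rfl
    · exact ⟨z, hyz.symm, (hm z).2 (Or.inr rfl), fun w hw => (hm w).1 hw⟩
    · exact ⟨y, hyz, (hm y).2 (Or.inl rfl), fun w hw => ((hm w).1 hw).symm⟩
  obtain ⟨a, ha⟩ : ∃ a, G.Adj b a := by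
    have h : (G.neighborFinset b).Nonempty := by
      rw [← Finset.card_pos, SimpleGraph.card_neighborFinset_eq_degree, h2]
      norm_num
    obtain ⟨a, ha⟩ := h
    exact ⟨a, (G.mem_neighborFinset b a).1 ha⟩
  obtain ⟨c, hca, hc, -⟩ := hN b a ha
  refine distinguishingIndex_le_of_label G 3 (by norm_num)
    (fun e => if e = s(b, a) then 0 else if e = s(b, c) then 1 else 2) fun σ hσ v => ?_
  have hne : s(b, c) ≠ s(b, a) := by
    simp only [ne_eq, Sym2.eq_iff, not_or, not_and]
    exact ⟨fun _ => hca, fun h => absurd h ha.ne⟩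
  have h1 : s(σ b, σ a) = s(b, a) := by
    have := hσ b a ha
    rw [if_pos (rfl : s(b, a) = s(b, a))] at this
    by_contra h
    rw [if_neg h] at this
    split_ifs at this <;> simp at this
  have h3 : s(σ b, σ c) = s(b, c) := by
    have := hσ b c hc
    rw [if_neg hne, if_pos (rfl : s(b, c) = s(b, c))] at this
    by_contra h
    rw [if_neg h] at this
    split_ifs at this <;> simp at this
  have hb : σ b = b ∧ σ a = a := by
    rw [Sym2.eq_iff] at h1 h3
    rcases h1 with h1 | h1
    · exact h1
    · rcases h3 with h3 | h3
      · exact absurd (h1.1.symm.trans h3.1) ha.ne'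
      · exact absurd (h3.1.symm.trans h1.1) hca
  refine (hG.forall_of_closed (P := fun x => σ x = x ∧ ∃ u, G.Adj x u ∧ σ u = u)
    (u := b) ⟨hb.1, a, ha, hb.2⟩ ?_ v).1
  rintro x y hxy ⟨hx, u, hu, hσu⟩
  refine ⟨?_, x, hxy.symm, hx⟩
  obtain ⟨w, hwu, hw, hall⟩ := hN x u hu
  have hσw : σ w = w := by
    have : G.Adj x (σ w) := by
      have := σ.map_rel_iff.2 hw
      rwa [hx] at this
    rcases hall _ this with h | h
    · exact absurd (σ.injective (h.trans hσu.symm)) hwu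
    · exact h
  rcases hall y hxy with rfl | rfl
  · exact hσu
  · exact hσw

/-- A connected finite graph has an injective ranking of its vertices in which every vertex other
than the root has a neighbor of smaller rank. -/
theorem SimpleGraph.Connected.exists_rank [Fintype V] (hG : G.Connected) (r : V) :
    ∃ ρ : V → ℕ, Function.Injective ρ ∧ ∀ x, x ≠ r → ∃ y, G.Adj x y ∧ ρ y < ρ x := by
  set N := Fintype.card V
  let e := Fintype.equivFin V
  -- Distance from the root dominates; the index `e x < N` breaks ties.
  refine ⟨fun x => G.dist r x * N + e x, ?_, ?_⟩
  · intro x y hxy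
    have h1 : (G.dist r x * N + e x) % N = (G.dist r y * N + e y) % N := congrArg (· % N) hxy
    rw [Nat.mul_add_mod_self_right, Nat.mul_add_mod_self_right, Nat.mod_eq_of_lt (e x).2,
      Nat.mod_eq_of_lt (e y).2] at h1
    exact e.injective (Fin.ext h1)
  · intro x hx
    obtain ⟨w, hw⟩ := hG.exists_walk_length_eq_dist x r
    cases w with
    | nil => exact absurd rfl hx
    | cons hadj w =>
      rename_i y
      refine ⟨y, hadj, ?_⟩
      have h1 := SimpleGraph.dist_le w
      rw [SimpleGraph.Walk.length_cons] at hw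
      rw [SimpleGraph.dist_comm] at hw h1
      have h2 : (G.dist r y + 1) * N ≤ G.dist r x * N := by
        apply Nat.mul_le_mul_right
        omega
      have h3 := (e y).2
      rw [Nat.add_mul, Nat.one_mul] at h2
      change G.dist r y * N + e y < G.dist r x * N + e x
      omega

/-- An injective map of `{0, …, m}` to itself that preserves adjacency of integers is the identity
or the reversal. -/
theorem eq_self_or_eq_sub_of_step {m : ℕ} {f : ℕ → ℕ} (hf : ∀ a ≤ m, f a ≤ m)
    (hinj : ∀ a b, a ≤ m → b ≤ m → f a = f b → a = b)
    (hstep : ∀ a < m, f (a + 1) = f a + 1 ∨ f a = f (a + 1) + 1) :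
    (∀ a ≤ m, f a = a) ∨ ∀ a ≤ m, f a = m - a := by
  rcases Nat.eq_zero_or_pos m with rfl | hm
  · refine Or.inl fun a ha => ?_
    have := hf a ha
    omega
  have h0 := hstep 0 hm
  rw [Nat.zero_add] at h0
  rcases h0 with h0 | h0
  · left
    have key : ∀ a ≤ m, f a = f 0 + a := by
      intro a
      induction a using Nat.strong_induction_on with
      | _ a ih =>
        intro ha
        rcases Nat.lt_or_ge a 2 with h | h
        · rcases (by omega : a = 0 ∨ a = 1) with rfl | rfl
          · rfl
          · omega
        obtain ⟨t, rfl⟩ : ∃ t, a = t + 2 := ⟨a - 2, by omega⟩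
        have h1 := ih t (by omega) (by omega)
        have h2 := ih (t + 1) (by omega) (by omega)
        have h3 := hstep (t + 1) (by omega)
        have h4 : f (t + 2) ≠ f t := fun h => by
          have := hinj _ _ ha (by omega) h
          omega
        rw [show t + 1 + 1 = t + 2 by omega] at h3
        omega
    intro a ha
    have h1 := key m le_rfl
    have h2 := hf m le_rfl
    have h3 := key a ha
    omega
  · right
    have key : ∀ a ≤ m, f a + a = f 0 := by
      intro a
      induction a using Nat.strong_induction_on with
      | _ a ih =>
        intro ha
        rcases Nat.lt_or_ge a 2 with h | h
        · rcases (by omega : a = 0 ∨ a = 1) with rfl | rfl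
          · rfl
          · omega
        obtain ⟨t, rfl⟩ : ∃ t, a = t + 2 := ⟨a - 2, by omega⟩
        have h1 := ih t (by omega) (by omega)
        have h2 := ih (t + 1) (by omega) (by omega)
        have h3 := hstep (t + 1) (by omega)
        have h4 : f (t + 2) ≠ f t := fun h => by
          have := hinj _ _ ha (by omega) h
          omega
        rw [show t + 1 + 1 = t + 2 by omega] at h3
        omega
    intro a ha
    have h1 := key m le_rfl
    have h2 := hf 0 (by omega)
    have h3 := key a ha
    omega

/-- A spanning forest of a graph rooted at a set `P`, in which every vertex outside `P` is joined
to its neighbor of least rank, together with labels that tell the children of a vertex apart. -/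
structure RankedForest (G : SimpleGraph V) (P : Set V) (L : Type*) where
  rank : V → ℕ
  rank_injective : Function.Injective rank
  parent : V → V
  adj_parent : ∀ x ∉ P, G.Adj x (parent x)
  rank_parent_lt : ∀ x ∉ P, rank (parent x) < rank x
  rank_parent_le : ∀ x ∉ P, ∀ y, G.Adj x y → rank (parent x) ≤ rank y
  label : V → L
  label_injective : ∀ x ∉ P, ∀ y ∉ P, parent x = parent y → label x = label y → x = y

namespace RankedForest

variable {P : Set V} {L : Type*} (F : RankedForest G P L)

theorem parent_edge_injective {x y : V} (hx : x ∉ P) (hy : y ∉ P)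
    (h : s(x, F.parent x) = s(y, F.parent y)) : x = y := by
  rw [Sym2.eq_iff] at h
  rcases h with h | ⟨h1, h2⟩
  · exact h.1
  · have h3 := F.rank_parent_lt x hx
    have h4 := F.rank_parent_lt y hy
    rw [← h1] at h4
    rw [h2] at h3
    omega

/-- An automorphism that fixes the roots and preserves the labels of the forest edges is trivial,
where every edge label is given by `c`. -/
theorem eq_self {c : Sym2 V → L} (hc : ∀ x ∉ P, c s(x, F.parent x) = F.label x) {σ : G ≃g G}
    (hσ : ∀ x y, G.Adj x y → c s(σ x, σ y) = c s(x, y)) (hP : ∀ x ∈ P, σ x = x) (x : V) :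
    σ x = x := by
  induction hn : F.rank x using Nat.strong_induction_on generalizing x with
  | _ n ih =>
    subst hn
    by_cases hx : x ∈ P
    · exact hP x hx
    have hlt := F.rank_parent_lt x hx
    have hpar := ih _ hlt _ rfl
    have hσx : σ x ∉ P := fun h => hx (by rwa [σ.injective (hP _ h)] at h)
    have hadj : G.Adj (σ x) (F.parent x) := by
      have := σ.map_rel_iff.2 (F.adj_parent x hx)
      rwa [hpar] at this
    have hpp : F.parent (σ x) = F.parent x := by
      apply F.rank_injective
      have hle := F.rank_parent_le _ hσx _ hadj
      -- The parent of `σ x` has rank below that of `x`, so it is fixed too; pulling its edge back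
      -- through `σ` makes it a neighbor of `x`.
      refine le_antisymm hle ?_
      have hfix := ih (F.rank (F.parent (σ x))) (by omega) _ rfl
      have h := F.adj_parent _ hσx
      rw [← hfix] at h
      exact F.rank_parent_le x hx _ (σ.map_rel_iff.1 h)
    have hlab := hσ x _ (F.adj_parent x hx)
    rw [hpar, hc x hx] at hlab
    nth_rewrite 1 [← hpp] at hlab
    rw [hc _ hσx] at hlab
    exact F.label_injective _ hσx _ hx hpp hlab

end RankedForest

theorem exists_injOn_mapsTo_of_card_le {L : Type*} [Nonempty L] (C : Finset V) (T : Finset L)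
    (h : C.card ≤ T.card) : ∃ g : V → L, Set.InjOn g C ∧ ∀ x ∈ C, g x ∈ T := by
  classical
  obtain ⟨e⟩ : Nonempty (C ↪ T) := Function.Embedding.nonempty_of_card_le (by simpa using h)
  refine ⟨fun x => if hx : x ∈ C then e ⟨x, hx⟩ else Classical.arbitrary L, ?_, ?_⟩
  · intro x hx y hy hxy
    simp only [Finset.mem_coe] at hx hy
    simp only [dif_pos hx, dif_pos hy] at hxy
    simpa using e.injective (Subtype.ext hxy)
  · intro x hx
    simp only [dif_pos hx]
    exact (e ⟨x, hx⟩).2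

variable [Fintype V] [DecidableRel G.Adj]

/-- Label 0 is withheld at the path, and the count still works: ends of a longest path have no
children, inner path vertices at most 4 - 2, and vertices off the path at most 4 - 1, the parent
taking one place. -/
theorem IsLongestPathSeq.exists_rankedForest (hG : G.Connected) {k : ℕ}
    (hk : G.IsRegularOfDegree k) (hk4 : k ≤ 4) {m : ℕ} {p : ℕ → V} (hp : IsLongestPathSeq G m p) :
    ∃ F : RankedForest G {x | ∃ i ≤ m, p i = x} (Fin 3),
      ∀ x, (¬ ∃ i ≤ m, p i = x) → (∃ i ≤ m, p i = F.parent x) → F.label x ≠ 0 := by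
  classical
  obtain ⟨ρ, hρ, hlt⟩ := hG.exists_rank (p 0)
  have hmin : ∀ x, ∃ y, (¬ ∃ i ≤ m, p i = x) → G.Adj x y ∧ ρ y < ρ x ∧
      ∀ z, G.Adj x z → ρ y ≤ ρ z := by
    intro x
    by_cases hx : ∃ i ≤ m, p i = x
    · exact ⟨x, fun h => absurd hx h⟩
    obtain ⟨y, hy, hyx⟩ := hlt x (fun h => hx ⟨0, by omega, h.symm⟩)
    obtain ⟨z, hz, hzmin⟩ := Finset.exists_min_image (G.neighborFinset x) ρ
      ⟨y, (G.mem_neighborFinset x y).2 hy⟩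
    refine ⟨z, fun _ => ⟨(G.mem_neighborFinset x z).1 hz, ?_, fun w hw =>
      hzmin w ((G.mem_neighborFinset x w).2 hw)⟩⟩
    exact (hzmin y ((G.mem_neighborFinset x y).2 hy)).trans_lt hyx
  choose π hπ using hmin
  let C : V → Finset V := fun v =>
    Finset.univ.filter fun x => (¬ ∃ i ≤ m, p i = x) ∧ π x = v
  have hCadj : ∀ v x, x ∈ C v → G.Adj v x := by
    intro v x hx
    obtain ⟨hoff, rfl⟩ := (Finset.mem_filter.1 hx).2
    exact (hπ x hoff).1.symm
  have hoff : ∀ v x, x ∈ C v → ¬ ∃ i ≤ m, p i = x := fun v x hx => (Finset.mem_filter.1 hx).2.1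
  have hcard : ∀ v (D : Finset V), D ⊆ G.neighborFinset v → Disjoint (C v) D →
      (C v).card + D.card ≤ 4 := by
    intro v D hD hdis
    have h1 : C v ∪ D ⊆ G.neighborFinset v :=
      Finset.union_subset (fun x hx => (G.mem_neighborFinset v x).2 (hCadj v x hx)) hD
    have h2 := Finset.card_le_card h1
    rw [Finset.card_union_of_disjoint hdis, SimpleGraph.card_neighborFinset_eq_degree, hk] at h2
    omega
  let T : V → Finset (Fin 3) := fun v => if ∃ i ≤ m, p i = v then {1, 2} else Finset.univ
  have hCT : ∀ v, (C v).card ≤ (T v).card := by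
    intro v
    by_cases hv : ∃ i ≤ m, p i = v
    · have hT : (T v).card = 2 := by simp [T, hv]
      rw [hT]
      obtain ⟨i, hi, rfl⟩ := hv
      rcases Nat.eq_zero_or_pos i with rfl | h0
      · rw [Finset.eq_empty_of_forall_notMem (s := C (p 0)) fun x hx =>
          hoff _ x hx (hp.mem_of_adj_zero (hCadj _ x hx))]
        simp
      rcases Nat.eq_or_lt_of_le hi with rfl | h1
      · rw [Finset.eq_empty_of_forall_notMem (s := C (p i)) fun x hx =>
          hoff _ x hx (hp.mem_of_adj_last (hCadj _ x hx))]
        simp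
      · have hne : p (i - 1) ≠ p (i + 1) := fun h => by
          have := hp.inj _ _ (by omega) (by omega) h
          omega
        have hadj : G.Adj (p i) (p (i - 1)) := by
          have := (hp.adj (i - 1) (by omega)).symm
          rwa [show i - 1 + 1 = i by omega] at this
        have := hcard (p i) {p (i - 1), p (i + 1)} ?_ ?_
        · rw [Finset.card_pair hne] at this
          omega
        · simp only [Finset.insert_subset_iff, Finset.singleton_subset_iff,
            SimpleGraph.mem_neighborFinset]
          exact ⟨hadj, hp.adj i h1⟩
        · rw [Finset.disjoint_right]
          intro x hx hxC
          simp only [Finset.mem_insert, Finset.mem_singleton] at hx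
          rcases hx with rfl | rfl
          · exact hoff _ _ hxC ⟨i - 1, by omega, rfl⟩
          · exact hoff _ _ hxC ⟨i + 1, by omega, rfl⟩
    · have hT : (T v).card = 3 := by simp [T, hv]
      rw [hT]
      have := hcard v {π v} ?_ ?_
      · rw [Finset.card_singleton] at this
        omega
      · rw [Finset.singleton_subset_iff, SimpleGraph.mem_neighborFinset]
        exact (hπ v hv).1
      · rw [Finset.disjoint_singleton_right]
        intro h
        have h1 := (Finset.mem_filter.1 h).2
        have h2 := (hπ _ h1.1).2.1
        rw [h1.2] at h2
        have h3 := (hπ v hv).2.1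
        omega
  choose g hg hgT using fun v => exists_injOn_mapsTo_of_card_le (C v) (T v) (hCT v)
  refine ⟨⟨ρ, hρ, π, fun x hx => (hπ x hx).1, fun x hx => (hπ x hx).2.1,
    fun x hx => (hπ x hx).2.2, fun x => g (π x) x, fun x hx y hy hxy hl => ?_⟩, fun x hx hpx => ?_⟩
  · refine hg (π x) ?_ ?_ (by simpa [hxy] using hl)
    · exact Finset.mem_coe.2 (Finset.mem_filter.2 ⟨Finset.mem_univ _, hx, rfl⟩)
    · exact Finset.mem_coe.2 (Finset.mem_filter.2 ⟨Finset.mem_univ _, hy, hxy.symm⟩)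
  · have h := hgT (π x) x (Finset.mem_filter.2 ⟨Finset.mem_univ _, hx, rfl⟩)
    have hT : T (π x) = {1, 2} := if_pos hpx
    rw [hT] at h
    intro h0
    change g (π x) x = 0 at h0
    rw [h0] at h
    simp at h

theorem SimpleGraph.Connected.distinguishingIndex_le_three_of_three_le (hG : G.Connected) {k : ℕ}
    (hk : G.IsRegularOfDegree k) (hk3 : 3 ≤ k) (hk4 : k ≤ 4) : distinguishingIndex G ≤ 3 := by
  classical
  have := hG.nonempty
  obtain ⟨m, p, hp⟩ := exists_isLongestPathSeq G
  obtain ⟨F, hF⟩ := hp.exists_rankedForest hG hk hk4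
  have hiff : ∀ x y, x ≤ m → y ≤ m → (p x = p y ↔ x = y) :=
    fun x y hx hy => ⟨hp.inj x y hx hy, fun h => h ▸ rfl⟩
  -- The last line concerns edges outside path and forest; singling out `p 0` there is what breaks
  -- the reversal.
  let c : Sym2 V → Fin 3 := fun e =>
    if h : ∃ x, (¬ ∃ i ≤ m, p i = x) ∧ e = s(x, F.parent x) then F.label h.choose
    else if ∃ i < m, e = s(p i, p (i + 1)) then 0
    else if p 0 ∈ e then 1 else 2
  have hforest : ∀ x, (¬ ∃ i ≤ m, p i = x) → c s(x, F.parent x) = F.label x := by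
    intro x hx
    have h : ∃ y, (¬ ∃ i ≤ m, p i = y) ∧ s(x, F.parent x) = s(y, F.parent y) := ⟨x, hx, rfl⟩
    simp only [c, dif_pos h]
    rw [← F.parent_edge_injective hx h.choose_spec.1 h.choose_spec.2]
  have hon : ∀ i j, i ≤ m → j ≤ m → c s(p i, p j) =
      if i + 1 = j ∨ j + 1 = i then 0 else if i = 0 ∨ j = 0 then 1 else 2 := by
    intro i j hi hj
    have h1 : ¬ ∃ x, (¬ ∃ i ≤ m, p i = x) ∧ s(p i, p j) = s(x, F.parent x) := by
      rintro ⟨x, hx, h⟩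
      rw [Sym2.eq_iff] at h
      rcases h with h | h
      · exact hx ⟨i, hi, h.1⟩
      · exact hx ⟨j, hj, h.2⟩
    have h2 : (∃ s < m, s(p i, p j) = s(p s, p (s + 1))) ↔ i + 1 = j ∨ j + 1 = i := by
      constructor
      · rintro ⟨s, hs, h⟩
        rw [Sym2.eq_iff, hiff i s hi (by omega), hiff i (s + 1) hi (by omega),
          hiff j s hj (by omega), hiff j (s + 1) hj (by omega)] at h
        omega
      · rintro (rfl | rfl)
        · exact ⟨i, by omega, rfl⟩
        · exact ⟨j, by omega, Sym2.eq_swap⟩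
    have h3 : p 0 ∈ s(p i, p j) ↔ i = 0 ∨ j = 0 := by
      rw [Sym2.mem_iff, hiff 0 i (by omega) hi, hiff 0 j (by omega) hj, eq_comm,
        eq_comm (a := (0 : ℕ)) (b := j)]
    simp only [c, dif_neg h1, h2, h3]
  -- An edge labeled 0 at a path vertex stays on the path.
  have hleave : ∀ i y, i ≤ m → G.Adj (p i) y → c s(p i, y) = 0 → ∃ j ≤ m, p j = y := by
    intro i y hi hadj h0
    by_contra hy
    by_cases h1 : F.parent y = p i
    · have h2 := hforest y hy
      rw [h1, Sym2.eq_swap, h0] at h2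
      exact hF y hy ⟨i, hi, h1.symm⟩ h2.symm
    · have h1 : ¬ ∃ x, (¬ ∃ i ≤ m, p i = x) ∧ s(p i, y) = s(x, F.parent x) := by
        rintro ⟨x, hx, h⟩
        rw [Sym2.eq_iff] at h
        rcases h with h | h
        · exact hx ⟨i, hi, h.1⟩
        · obtain ⟨ha, rfl⟩ := h
          exact h1 ha.symm
      have h2 : ¬ ∃ s < m, s(p i, y) = s(p s, p (s + 1)) := by
        rintro ⟨s, hs, h⟩
        rw [Sym2.eq_iff] at h
        rcases h with h | h
        · exact hy ⟨s + 1, by omega, h.2.symm⟩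
        · exact hy ⟨s, by omega, h.2.symm⟩
      simp only [c, dif_neg h1, if_neg h2] at h0
      split_ifs at h0 <;> simp at h0
  refine distinguishingIndex_le_of_label G 3 (by norm_num) c fun σ hσ v => ?_
  have hzero : ∀ i < m, c s(σ (p i), σ (p (i + 1))) = 0 := by
    intro i hi
    rw [hσ _ _ (hp.adj i hi), hon i (i + 1) (by omega) (by omega)]
    simp
  have hpath : IsPathSeq G m (fun i => σ (p i)) :=
    ⟨fun i hi => σ.map_rel_iff.2 (hp.adj i hi), fun i j hi hj h => hp.inj i j hi hj (σ.injective h)⟩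
  obtain ⟨i₀, j₀, hi₀, hj₀, hij₀⟩ := hp.exists_common hG hpath
  have hup : ∀ t, j₀ + t ≤ m → ∃ i ≤ m, p i = σ (p (j₀ + t)) := by
    intro t
    induction t with
    | zero => exact fun _ => ⟨i₀, hi₀, hij₀⟩
    | succ t ih =>
      intro ht
      obtain ⟨i, hi, h⟩ := ih (by omega)
      refine hleave i _ hi ?_ ?_
      · rw [h]
        exact hpath.adj (j₀ + t) (by omega)
      · rw [h]
        exact hzero (j₀ + t) (by omega)
  have hdown : ∀ t, t ≤ j₀ → ∃ i ≤ m, p i = σ (p (j₀ - t)) := by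
    intro t
    induction t with
    | zero => exact fun _ => ⟨i₀, hi₀, hij₀⟩
    | succ t ih =>
      intro ht
      obtain ⟨i, hi, h⟩ := ih (by omega)
      have ht' : j₀ - t = j₀ - (t + 1) + 1 := by omega
      rw [ht'] at h
      refine hleave i _ hi ?_ ?_
      · rw [h]
        exact (hpath.adj (j₀ - (t + 1)) (by omega)).symm
      · rw [h, Sym2.eq_swap]
        exact hzero (j₀ - (t + 1)) (by omega)
  have hmaps : ∀ a, ∃ i, a ≤ m → i ≤ m ∧ p i = σ (p a) := by
    intro a
    by_cases ha : a ≤ m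
    · rcases le_total j₀ a with h | h
      · obtain ⟨i, hi, h'⟩ := hup (a - j₀) (by omega)
        exact ⟨i, fun _ => ⟨hi, by rwa [show j₀ + (a - j₀) = a by omega] at h'⟩⟩
      · obtain ⟨i, hi, h'⟩ := hdown (j₀ - a) (by omega)
        exact ⟨i, fun _ => ⟨hi, by rwa [show j₀ - (j₀ - a) = a by omega] at h'⟩⟩
    · exact ⟨0, fun h => absurd h ha⟩
  choose f hf using hmaps
  have hstep : ∀ a < m, f (a + 1) = f a + 1 ∨ f a = f (a + 1) + 1 := by
    intro a ha
    obtain ⟨h1, h2⟩ := hf a (by omega)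
    obtain ⟨h3, h4⟩ := hf (a + 1) (by omega)
    have h := hzero a ha
    rw [← h2, ← h4, hon _ _ h1 h3] at h
    split_ifs at h with h5 h6
    · omega
    all_goals simp at h
  rcases eq_self_or_eq_sub_of_step (fun a ha => (hf a ha).1) (fun a b ha hb hab =>
    hpath.inj a b ha hb (by simp only [← (hf a ha).2, ← (hf b hb).2, hab])) hstep with hid | hrev
  · refine F.eq_self hforest hσ ?_ v
    rintro x ⟨i, hi, rfl⟩
    rw [← (hf i hi).2, hid i hi]
  · exfalso
    have hm0 : σ (p m) = p 0 := by
      rw [← (hf m le_rfl).2, hrev m le_rfl, Nat.sub_self]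
    -- As k ≥ 3, `p m` has a neighbor besides `p 0` and `p (m - 1)`; it lies on the path and the
    -- edge has label 2. A reversal would carry it to an edge between `p 0` and a path vertex,
    -- labeled 0 or 1.
    have hchord : ∃ y, G.Adj (p m) y ∧ y ∉ ({p 0, p (m - 1)} : Finset V) := by
      by_contra! h
      have h1 : G.neighborFinset (p m) ⊆ {p 0, p (m - 1)} := fun y hy =>
        h y ((G.mem_neighborFinset _ y).1 hy)
      have h2 := (Finset.card_le_card h1).trans Finset.card_le_two
      rw [SimpleGraph.card_neighborFinset_eq_degree, hk] at h2
      omega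
    obtain ⟨y, hadj, hy⟩ := hchord
    simp only [Finset.mem_insert, Finset.mem_singleton, not_or] at hy
    obtain ⟨j, hj, rfl⟩ := hp.mem_of_adj_last hadj
    have hj0 : j ≠ 0 := fun h => hy.1 (by rw [h])
    have hj1 : j ≠ m - 1 := fun h => hy.2 (by rw [h])
    have hc2 : c s(p m, p j) = 2 := by
      rw [hon m j le_rfl hj, if_neg (by omega), if_neg (by omega)]
    obtain ⟨h1, h2⟩ := hf j hj
    have h3 := hσ _ _ hadj
    rw [hc2, hm0, ← h2, hon 0 _ (by omega) h1] at h3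
    by_cases h4 : 0 + 1 = f j ∨ f j + 1 = 0
    · rw [if_pos h4] at h3
      exact absurd h3 (by decide)
    · rw [if_neg h4, if_pos (Or.inl rfl)] at h3
      exact absurd h3 (by decide)

/-- A connected regular graph of degree at most four other than `K₂` has distinguishing index at
most three. -/
theorem SimpleGraph.Connected.distinguishingIndex_le_three (hG : G.Connected) {k : ℕ}
    (hk : G.IsRegularOfDegree k) (hk4 : k ≤ 4) (hn : Fintype.card V ≠ 2) :
    distinguishingIndex G ≤ 3 := by
  classical
  obtain ⟨v⟩ := hG.nonempty
  rcases Nat.lt_or_ge k 3 with h | h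
  · interval_cases k
    · refine distinguishingIndex_le_of_label G 3 (by norm_num) (fun _ => 0) fun σ _ x => ?_
      have hall : ∀ x, x = v := hG.forall_of_closed rfl (fun x y hxy _ => by
        have h1 := (G.degree_pos_iff_exists_adj x).2 ⟨y, hxy⟩
        rw [hk x] at h1
        omega)
      rw [hall (σ x), hall x]
    · exfalso
      have hN : ∀ x y z, G.Adj x y → G.Adj x z → y = z := by
        intro x y z hy hz
        obtain ⟨w, hw⟩ := Finset.card_eq_one.1
          ((SimpleGraph.card_neighborFinset_eq_degree G x).trans (hk x))
        have h1 := (G.mem_neighborFinset x y).2 hy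
        have h2 := (G.mem_neighborFinset x z).2 hz
        rw [hw, Finset.mem_singleton] at h1 h2
        rw [h1, h2]
      obtain ⟨w, hw⟩ := (G.degree_pos_iff_exists_adj v).1 (by rw [hk v]; norm_num)
      have hall : ∀ x, x = v ∨ x = w := hG.forall_of_closed (Or.inl rfl) (by
        rintro x y hxy (rfl | rfl)
        · exact Or.inr (hN _ _ _ hxy hw)
        · exact Or.inl (hN _ _ _ hxy hw.symm))
      apply hn
      rw [← Finset.card_univ, ← Finset.card_pair hw.ne]
      congr 1
      ext x
      simpa using hall x
    · exact hG.distinguishingIndex_le_three_of_two hk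
  · exact hG.distinguishingIndex_le_three_of_three_le hk h hk4

end SmallDegree

/-! ### Graphical regular representations -/

theorem exists_ne_ne_of_three_le_card {H : Type*} [Finite H] (h3 : 3 ≤ Nat.card H) (x y : H) :
    ∃ z, z ≠ x ∧ z ≠ y := by
  classical
  have := Fintype.ofFinite H
  by_contra! hz
  have h1 : (Finset.univ : Finset H) ⊆ {x, y} := fun z _ => by
    by_cases h : z = x
    · simp [h]
    · simp [hz z h]
  have h2 := (Finset.card_le_card h1).trans Finset.card_le_two
  rw [Finset.card_univ, ← Nat.card_eq_fintype_card] at h2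
  omega

section Cayley

variable {H : Type*} [Group H]

theorem IsGraphicalRegularRepresentation.exists_eq_mul {Γ : SimpleGraph H}
    (h : IsGraphicalRegularRepresentation Γ) (σ : Γ ≃g Γ) : ∃ a : H, ∀ x, σ x = x * a := by
  obtain ⟨a, ha⟩ : σ.toEquiv ∈ Set.range (fun a : H => Equiv.mulRight a) := h ▸ ⟨σ, rfl⟩
  exact ⟨a, fun x => (Equiv.congr_fun ha x).symm⟩

/-- The connection set of a graphical regular representation of a group of order at least three
has at least two elements. -/
theorem IsGraphicalRegularRepresentation.exists_mem_ne [Finite H] {S : Set H}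
    {h_one : (1 : H) ∉ S} {h_inv : ∀ s ∈ S, s⁻¹ ∈ S} (h3 : 3 ≤ Nat.card H)
    (h : IsGraphicalRegularRepresentation (cayleyGraph S h_one h_inv)) {s : H} (hs : s ≠ 1) :
    ∃ t ∈ S, t ≠ s := by
  classical
  by_contra! hS
  have hmul : ∀ t ∈ S, t = s ∧ s * s = 1 := by
    intro t ht
    have h1 := hS t ht
    have h2 := hS _ (h_inv t ht)
    subst h1
    refine ⟨rfl, ?_⟩
    nth_rewrite 1 [← h2]
    simp
  -- With S ⊆ {s} the graph is edgeless or a perfect matching, so exchanging 1 and `s` is an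
  -- automorphism. It fixes a third vertex, which no nontrivial translation does.
  have key : ∀ x y, (cayleyGraph S h_one h_inv).Adj x y →
      (cayleyGraph S h_one h_inv).Adj (Equiv.swap 1 s x) (Equiv.swap 1 s y) := by
    rintro x y ⟨t, ht, rfl⟩
    obtain ⟨rfl, hss⟩ := hmul t ht
    by_cases h1 : x = 1
    · subst h1
      exact ⟨t, ht, by simp [hss]⟩
    by_cases h2 : x = t
    · subst h2
      exact ⟨x, ht, by simp [hss]⟩
    have h3 : t * x ≠ 1 := fun h0 => h2 (mul_left_cancel (h0.trans hss.symm))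
    have h4 : t * x ≠ t := by simpa using h1
    rw [Equiv.swap_apply_of_ne_of_ne h1 h2, Equiv.swap_apply_of_ne_of_ne h3 h4]
    exact ⟨t, ht, rfl⟩
  let σ : cayleyGraph S h_one h_inv ≃g cayleyGraph S h_one h_inv :=
    { Equiv.swap 1 s with
      map_rel_iff' := fun {x y} => ⟨fun hxy => by simpa using key _ _ hxy, key x y⟩ }
  obtain ⟨a, ha⟩ := h.exists_eq_mul σ
  obtain ⟨z, hz1, hzs⟩ := exists_ne_ne_of_three_le_card h3 1 s
  have h5 : z = z * a := (Equiv.swap_apply_of_ne_of_ne hz1 hzs).symm.trans (ha z)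
  have h6 : s = 1 * a := (Equiv.swap_apply_left 1 s).symm.trans (ha 1)
  have h7 : a = 1 := by simpa using h5
  exact hs (by simpa [h7] using h6)

/-- Translation by `a ≠ 1` sends the edge {1, t} to {a, ta}, which misses 1 as soon as `t ≠ a⁻¹`. -/
theorem cayleyGraph_eq_of_preserves_incident [Finite H] {S : Set H} {h_one : (1 : H) ∉ S}
    {h_inv : ∀ s ∈ S, s⁻¹ ∈ S} (h3 : 3 ≤ Nat.card H)
    (h : IsGraphicalRegularRepresentation (cayleyGraph S h_one h_inv))
    (σ : cayleyGraph S h_one h_inv ≃g cayleyGraph S h_one h_inv)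
    (hσ : ∀ s ∈ S, 1 ∈ s(σ 1, σ s)) (x : H) : σ x = x := by
  obtain ⟨a, ha⟩ := h.exists_eq_mul σ
  by_cases h1 : a = 1
  · simp [ha, h1]
  obtain ⟨t, ht, hne⟩ := h.exists_mem_ne h3 (inv_ne_one.2 h1)
  have := hσ t ht
  rw [ha, ha, one_mul, Sym2.mem_iff] at this
  rcases this with h4 | h4
  · exact absurd h4.symm h1
  · exact absurd (eq_inv_of_mul_eq_one_left h4.symm) hne

theorem cayleyGraph_distinguishing [Finite H] {S : Set H} {h_one : (1 : H) ∉ S}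
    {h_inv : ∀ s ∈ S, s⁻¹ ∈ S} (h3 : 3 ≤ Nat.card H)
    (h : IsGraphicalRegularRepresentation (cayleyGraph S h_one h_inv)) :
    distinguishingIndex (cayleyGraph S h_one h_inv) = 2 := by
  classical
  refine le_antisymm ?_ (two_le_distinguishingIndex _ ?_)
  · refine distinguishingIndex_le_of_label _ 2 (by norm_num)
      (fun e => if (1 : H) ∈ e then 0 else 1) fun σ hσ x => ?_
    refine cayleyGraph_eq_of_preserves_incident h3 h σ (fun s hs => ?_) x
    have := hσ 1 s ⟨s, hs, by simp⟩
    by_contra h0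
    simp [h0] at this
  · obtain ⟨a, ha, -⟩ := exists_ne_ne_of_three_le_card h3 (1 : H) 1
    obtain ⟨σ, hσ⟩ : Equiv.mulRight a ∈ Set.range
      (fun σ : cayleyGraph S h_one h_inv ≃g cayleyGraph S h_one h_inv => σ.toEquiv) :=
      h ▸ ⟨a, rfl⟩
    refine ⟨σ, ?_⟩
    rintro rfl
    have := Equiv.congr_fun hσ 1
    exact ha (by simpa using this.symm)

open Classical in
theorem cayleyGraph_isDistinguishingEdgeLabeling [Finite H] {S : Set H} {h_one : (1 : H) ∉ S}
    {h_inv : ∀ s ∈ S, s⁻¹ ∈ S} (h3 : 3 ≤ Nat.card H)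
    (h : IsGraphicalRegularRepresentation (cayleyGraph S h_one h_inv)) :
    IsDistinguishingEdgeLabeling (cayleyGraph S h_one h_inv)
      (fun ε => if (1 : H) ∈ (ε : Sym2 H) then (1 : ℕ) else 2) := by
  intro σ hσ
  ext x
  refine cayleyGraph_eq_of_preserves_incident h3 h σ (fun s hs => ?_) x
  have h1 : (if (1 : H) ∈ s(σ 1, σ s) then (1 : ℕ) else 2) =
      if (1 : H) ∈ s((1 : H), s) then (1 : ℕ) else 2 :=
    hσ ⟨s(1, s), ⟨s, hs, by simp⟩⟩
  by_contra h0
  simp [h0] at h1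

end Cayley

open Classical in
theorem mainTheorem2 :
    (∀ (V : Type*) [Fintype V] (Γ : SimpleGraph V) (k n : ℕ),
      Γ.IsRegularOfDegree k → Fintype.card V = n →
        (Γ.Connected → n ≠ 2 → k ≤ 4 → distinguishingIndex Γ ≤ 3) ∧
        ((k : ℝ) ≥ ((n : ℝ) - 1) / 2 → ((n : ℝ) - 1) / 2 ≥ 3 →
          distinguishingIndex Γ ≤ 2 ∧
          ((∃ σ : Γ ≃g Γ, σ ≠ SimpleGraph.Iso.refl) → distinguishingIndex Γ = 2))) ∧
    (∀ (H : Type*) [Group H] [Finite H] (S : Set H) (h_one : (1 : H) ∉ S)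
      (h_inv : ∀ s ∈ S, s⁻¹ ∈ S),
      3 ≤ Nat.card H →
      IsGraphicalRegularRepresentation (cayleyGraph S h_one h_inv) →
        distinguishingIndex (cayleyGraph S h_one h_inv) = 2 ∧
        IsDistinguishingEdgeLabeling (cayleyGraph S h_one h_inv)
          (fun ε => if (1 : H) ∈ (ε : Sym2 H) then (1 : ℕ) else 2)) := by
  refine ⟨fun V _ Γ k n hk hn => ⟨fun hG hn2 hk4 => ?_, fun h1 h2 => ?_⟩,
    fun H _ _ S h_one h_inv h3 h =>
      ⟨cayleyGraph_distinguishing h3 h, cayleyGraph_isDistinguishingEdgeLabeling h3 h⟩⟩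
  · exact hG.distinguishingIndex_le_three hk hk4 (hn ▸ hn2)
  · have hle : Fintype.card V ≤ 2 * k + 1 := by
      rw [hn]
      have : (n : ℝ) ≤ 2 * k + 1 := by linarith
      exact_mod_cast this
    have h7 : 7 ≤ Fintype.card V := by
      rw [hn]
      have : (7 : ℝ) ≤ n := by linarith
      exact_mod_cast this
    have hle2 := hk.distinguishingIndex_le_two hle h7
    exact ⟨hle2, fun hσ => le_antisymm hle2 (two_le_distinguishingIndex Γ hσ)⟩
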